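/- Let $d\ge 1$. Let $\mathrm{BW}(\mathbb R^d)$ be the set of Gaussian measures $\mathcal N(m,\Sigma)$ on $\mathbb R^d$ with $m\in\mathbb R^d$ and $\Sigma$ symmetric positive definite. For $K\ge 1$ let $\mathrm{GMM}_d(K)$ be the set of Gaussian mixtures with $K$ components, i.e. of discrete probability distributions $\mathbb P=\sum_{k=1}^K\alpha_k\delta_{\mu_k}$ on $\mathrm{BW}(\mathbb R^d)$, where $\alpha_k\ge 0$, $\sum_k\alpha_k=1$ and $\mu_k\in \mathrm{BW}(\mathbb R^d)$. Let $\mathrm W_2$ be the $2$-Wasserstein distance, $\mathrm W_2^2(\mu,\nu)=\inf_{\gamma\in\Pi(\mu,\nu)}\int |x-y|^2\,\mathrm d\gamma(x,y)$ for $\mu,\nu\in\mathcal P_2(\mathbb R)$. For $m_1\in[-1,1]$ put $\sigma_1=1+\sqrt{1-m_1^2}$ and, for $t\ge 0$, $\eta^{m_1}_t=\mathcal N\big(t m_1,((1-t)+t\sigma_1)^2\big)$, so that $\eta^{m_1}_0=\mathcal N(0,1)$ and $\eta^{m_1}_1=\mathcal N(m_1,\sigma_1^2)$. The Busemann function of this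 curve is $$B^{\eta^{m_1}}(\nu)=\lim_{t\to\infty}\Big(\mathrm W_2(\eta^{m_1}_t,\nu)-t\,\mathrm W_2(\eta^{m_1}_0,\eta^{m_1}_1)\Big).$$ For $\theta\in S^{d-1}$ let $\varphi^\theta(\mu)=P^\theta_\#\mu$ with $P^\theta(x)=\langle\theta,x\rangle$. With $\lambda=\mathcal U(S^{d-1}\times[-1,1])$, the Busemann 1D Gaussian Mixture Sliced-Wasserstein discrepancy is the non-negative number defined by $$\mathrm{B1DGMSW}^2(\mathbb P,\mathbb Q)=\int \mathrm W_2^2\big(B^{\eta^{m_1}}_\#\varphi^\theta_\#\mathbb P,\;B^{\eta^{m_1}}_\#\varphi^\theta_\#\mathbb Q\big)\,\mathrm d\lambda(\theta,m_1).$$ **Proposition.** $\mathrm{B1DGMSW}$ is a well-defined distance on the space $\bigcup_{K>0}\mathrm{GMM}_d(K)$ of finite Gaussian mixtures on $\mathbb R^d$. That is: 1. for every $m_1\in[-1,1]$, $\eta^{m_1}$ is a unit-speed geodesic ray: $\mathrm W_2(\eta^{m_1}_0,\eta^{m_1}_1)=1$ and $\mathrm W_2(\eta^{m_1}_s,\eta^{m_1}_t)=|s-t|$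 for all $s,t\ge 0$; 2. for all $m_1\in[-1,1]$, $\theta\in S^{d-1}$ and $\mu\in\mathrm{BW}(\mathbb R^d)$, the limit defining $B^{\eta^{m_1}}(\varphi^\theta(\mu))$ exists and is finite; 3. for all $\mathbb P,\mathbb Q\in\bigcup_{K>0}\mathrm{GMM}_d(K)$, the integrand in the definition of $\mathrm{B1DGMSW}^2(\mathbb P,\mathbb Q)$ is $\lambda$-measurable; 4. for all $\mathbb P,\mathbb Q,\mathbb S\in\bigcup_{K>0}\mathrm{GMM}_d(K)$: $0\le\mathrm{B1DGMSW}(\mathbb P,\mathbb Q)<\infty$; $\mathrm{B1DGMSW}(\mathbb P,\mathbb Q)=0$ if and only if $\mathbb P=\mathbb Q$; $\mathrm{B1DGMSW}(\mathbb P,\mathbb Q)=\mathrm{B1DGMSW}(\mathbb Q,\mathbb P)$; and $\mathrm{B1DGMSW}(\mathbb P,\mathbb S)\le\mathrm{B1DGMSW}(\mathbb P,\mathbb Q)+\mathrm{B1DGMSW}(\mathbb Q,\mathbb S)$. -/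

import Mathlib

open MeasureTheory ProbabilityTheory Filter Topology Set
open scoped ENNReal NNReal RealInnerProductSpace

noncomputable section

namespace BusemannGMM

/-- The couplings of `μ` and `ν`: measures on the product with marginals `μ` and `ν`. -/
def couplings {X : Type*} [MeasurableSpace X] (μ ν : Measure X) : Set (Measure (X × X)) :=
  {γ | γ.map Prod.fst = μ ∧ γ.map Prod.snd = ν}

/-- The squared `2`-Wasserstein distance
`W₂²(μ, ν) = inf_{γ ∈ Π(μ, ν)} ∫ d(x, y)² dγ(x, y)`, with values in `[0, ∞]`. -/
def W2sq {X : Type*} [MeasurableSpace X] [PseudoEMetricSpace X] (μ ν : Measure X) : ℝ≥0∞ :=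
  ⨅ γ ∈ couplings μ ν, ∫⁻ p, edist p.1 p.2 ^ 2 ∂γ

/-- The `2`-Wasserstein distance `W₂(μ, ν)`, with values in `[0, ∞]`. -/
def W2 {X : Type*} [MeasurableSpace X] [PseudoEMetricSpace X] (μ ν : Measure X) : ℝ≥0∞ :=
  W2sq μ ν ^ (1 / 2 : ℝ)

/-- `(η_t)_{t ≥ 0}` is a geodesic ray for `W₂`:
`W₂(η_s, η_t) = |s - t| W₂(η₀, η₁)` for all `s, t ≥ 0`. -/
def IsGeodesicRay (η : ℝ → Measure ℝ) : Prop :=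
  ∀ s t : ℝ, 0 ≤ s → 0 ≤ t → W2 (η s) (η t) = ENNReal.ofReal |s - t| * W2 (η 0) (η 1)

/-- The function `t ↦ W₂(η_t, ν) - t W₂(η₀, η₁)`, whose limit at infinity is the Busemann
function of `η` at `ν`. -/
def busemannApprox (η : ℝ → Measure ℝ) (ν : Measure ℝ) (t : ℝ) : ℝ :=
  (W2 (η t) ν).toReal - t * (W2 (η 0) (η 1)).toReal

/-- The Busemann function `B^η(ν) = lim_{t → ∞} (W₂(η_t, ν) - t W₂(η₀, η₁))`. -/
def busemann (η : ℝ → Measure ℝ) (ν : Measure ℝ) : ℝ :=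
  limUnder atTop (busemannApprox η ν)

/-- The curve `t ↦ N((1 - t) m₀ + t m₁, ((1 - t) σ₀ + t σ₁)²)` through `N(m₀, σ₀²)` (at `t = 0`)
and `N(m₁, σ₁²)` (at `t = 1`). -/
def gaussianCurve (m₀ σ₀ m₁ σ₁ t : ℝ) : Measure ℝ :=
  gaussianReal ((1 - t) * m₀ + t * m₁) (((1 - t) * σ₀ + t * σ₁) ^ 2).toNNReal

/-- The ray `η^{m₁}` starting at `η₀ = N(0, 1)` and passing at time `1` through
`η₁ = N(m₁, σ₁²)` with `σ₁ = 1 + √(1 - m₁²)`. -/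
def slicingRay (m₁ : ℝ) : ℝ → Measure ℝ :=
  gaussianCurve 0 1 m₁ (1 + √(1 - m₁ ^ 2))

/-- The space of Gaussian measures `N(m, Σ)` on `ℝ^d` with `Σ` symmetric positive definite. -/
def BW (d : ℕ) : Type :=
  {μ : Measure (EuclideanSpace ℝ (Fin d)) //
    ∃ (m : EuclideanSpace ℝ (Fin d)) (S : Matrix (Fin d) (Fin d) ℝ),
      S.PosDef ∧ μ = multivariateGaussian m S}

/-- The Gaussian mixtures with `K` components: the discrete probability distributions
`∑ₖ αₖ δ_{μₖ}` on the space of Gaussian measures, `α` being a probability vector of length `K`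
(the law of `μ_k` when the index `k` is drawn with probability `αₖ`). -/
def GMM (d K : ℕ) : Set (PMF (BW d)) :=
  {P | ∃ (α : PMF (Fin K)) (μ : Fin K → BW d), P = α.map μ}

/-- The finite Gaussian mixtures on `ℝ^d`, with any number `K > 0` of components. -/
def finiteGMM (d : ℕ) : Set (PMF (BW d)) :=
  ⋃ (K : ℕ) (_ : 0 < K), GMM d K

/-- The unit sphere `S^{d-1}` of `ℝ^d`. -/
abbrev UnitSphere (d : ℕ) : Type := Metric.sphere (0 : EuclideanSpace ℝ (Fin d)) 1

/-- The projection `φ^θ(μ) = P^θ_# μ` of a Gaussian measure, with `P^θ(x) = ⟨θ, x⟩`. -/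
def proj {d : ℕ} (θ : UnitSphere d) (μ : BW d) : Measure ℝ :=
  μ.1.map (fun x => ⟪(θ : EuclideanSpace ℝ (Fin d)), x⟫)

/-- The projected mixture `B^{η^{m₁}}_# φ^θ_# P`, a probability measure on `ℝ`. -/
def projMixture {d : ℕ} (θ : UnitSphere d) (m₁ : ℝ) (P : PMF (BW d)) : Measure ℝ :=
  ((P.map (proj θ)).map (busemann (slicingRay m₁))).toMeasure

/-- The uniform probability measure on `S^{d-1}`: the normalized surface measure. -/
def uniformSphere (d : ℕ) : Measure (UnitSphere d) :=
  ((volume : Measure (EuclideanSpace ℝ (Fin d))).toSphere univ)⁻¹ •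
    (volume : Measure (EuclideanSpace ℝ (Fin d))).toSphere

/-- The uniform probability measure on `[-1, 1]`, as a measure on `ℝ`. -/
def uniformInterval : Measure ℝ :=
  (volume (Icc (-1 : ℝ) 1))⁻¹ • volume.restrict (Icc (-1 : ℝ) 1)

/-- The uniform probability measure on `S^{d-1} × [-1, 1]`. -/
def slicingMeasure (d : ℕ) : Measure (UnitSphere d × ℝ) :=
  (uniformSphere d).prod uniformInterval

/-- The Busemann 1D Gaussian Mixture Sliced-Wasserstein discrepancy, the square root of
`∫ W₂²(B^{η^{m₁}}_# φ^θ_# P, B^{η^{m₁}}_# φ^θ_# Q) dλ(θ, m₁)`, with values in `[0, ∞]`. -/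
def B1DGMSW {d : ℕ} (P Q : PMF (BW d)) : ℝ≥0∞ :=
  (∫⁻ z, W2sq (projMixture z.1 z.2 P) (projMixture z.1 z.2 Q) ∂(slicingMeasure d)) ^ (1 / 2 : ℝ)

/-- `D` is a distance on the set `S`: finite, symmetric, subject to the triangle inequality, and
zero exactly on the diagonal. -/
structure IsDistanceOn {X : Type*} (S : Set X) (D : X → X → ℝ≥0∞) : Prop where
  finite : ∀ x ∈ S, ∀ y ∈ S, D x y < ∞
  eq_zero_iff : ∀ x ∈ S, ∀ y ∈ S, D x y = 0 ↔ x = y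
  symm : ∀ x ∈ S, ∀ y ∈ S, D x y = D y x
  triangle : ∀ x ∈ S, ∀ y ∈ S, ∀ z ∈ S, D x z ≤ D x y + D y z

end BusemannGMM

end

/-! In the coordinates (mean, standard deviation), `W2` between nondegenerate Gaussians on the line
is the Euclidean distance (`W2_gaussianReal`). So the slicing curve is a straight ray from (0, 1) in
the unit direction (m₁, √(1 - m₁²)), and its Busemann function is affine in these coordinates. A
finite mixture thus projects to a finitely supported law with fixed weights and with atoms
continuous in (θ, m₁) (`busemannValue`). Hence `W2` between two projected mixtures is finite and
continuous in (θ, m₁). This gives measurability and, by compactness, finiteness; the triangle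
inequality is that of `W2` followed by Minkowski in L²(λ).

For separation, a zero discrepancy makes this continuous function vanish at every slice with m₁ in
the open interval (-1, 1), because λ charges neighbourhoods of such slices. One slice that is
injective on the finitely many components of both mixtures then suffices
(`exists_injOn_busemannValue`). It exists because a nonzero polynomial yields a direction θ
separating all pairs, after which only finitely many m₁ are bad. -/

namespace BusemannGMM

/-! ### Couplings and the Wasserstein distance -/

section Wasserstein

variable {X : Type*} [MeasurableSpace X]

theorem swap_mem_couplings {μ ν : Measure X} {γ : Measure (X × X)} (h : γ ∈ couplings μ ν) :
    γ.map Prod.swap ∈ couplings ν μ := by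
  refine ⟨?_, ?_⟩
  · rw [Measure.map_map measurable_fst measurable_swap]; exact h.2
  · rw [Measure.map_map measurable_snd measurable_swap]; exact h.1

theorem couplings_isProbabilityMeasure {μ ν : Measure X} [IsProbabilityMeasure μ]
    {γ : Measure (X × X)} (h : γ ∈ couplings μ ν) : IsProbabilityMeasure γ := by
  refine ⟨?_⟩
  rw [← measure_univ (μ := μ), ← h.1, Measure.map_apply measurable_fst .univ, preimage_univ]

/-- Two couplings with a common middle marginal are the marginals of a measure on the triple
product. -/
theorem exists_gluing [StandardBorelSpace X] [Nonempty X] {μ ν ρ : Measure X}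
    [IsProbabilityMeasure μ] [IsProbabilityMeasure ν] {γ₁ γ₂ : Measure (X × X)}
    (h₁ : γ₁ ∈ couplings μ ν) (h₂ : γ₂ ∈ couplings ν ρ) :
    ∃ Γ : Measure ((X × X) × X), Γ.map Prod.fst = γ₁ ∧ Γ.map (fun q => (q.1.2, q.2)) = γ₂ := by
  have := couplings_isProbabilityMeasure h₁
  have := couplings_isProbabilityMeasure h₂
  -- Draw from `γ₁`, then draw the third coordinate from the conditional law of `γ₂` given the
  -- second one.
  refine ⟨γ₁ ⊗ₘ (γ₂.condKernel.comap Prod.snd measurable_snd), Measure.fst_compProd _ _, ?_⟩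
  refine Measure.ext_of_lintegral _ fun f hf => ?_
  have hm : Measurable fun q : (X × X) × X => (q.1.2, q.2) := by fun_prop
  rw [lintegral_map hf hm, Measure.lintegral_compProd (by fun_prop)]
  conv_rhs => rw [← γ₂.disintegrate γ₂.condKernel, Measure.lintegral_compProd hf]
  have hfst : γ₂.fst = γ₁.map Prod.snd := h₂.1.trans h₁.2.symm
  rw [hfst, lintegral_map (hf.lintegral_kernel_prod_right') measurable_snd]
  rfl

variable [PseudoEMetricSpace X]

theorem W2sq_le_of_mem {μ ν : Measure X} {γ : Measure (X × X)} (h : γ ∈ couplings μ ν) :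
    W2sq μ ν ≤ ∫⁻ p, edist p.1 p.2 ^ 2 ∂γ :=
  iInf₂_le γ h

theorem W2_le_of_mem {μ ν : Measure X} {γ : Measure (X × X)} (h : γ ∈ couplings μ ν) :
    W2 μ ν ≤ (∫⁻ p, edist p.1 p.2 ^ 2 ∂γ) ^ (1 / 2 : ℝ) :=
  ENNReal.rpow_le_rpow (W2sq_le_of_mem h) (by norm_num)

theorem W2_sq (μ ν : Measure X) : W2 μ ν ^ 2 = W2sq μ ν := by
  rw [W2, ← ENNReal.rpow_natCast, ← ENNReal.rpow_mul]; norm_num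

theorem exists_coupling_lt {μ ν : Measure X} {c : ℝ≥0∞} (h : W2 μ ν < c) :
    ∃ γ ∈ couplings μ ν, (∫⁻ p, edist p.1 p.2 ^ 2 ∂γ) ^ (1 / 2 : ℝ) < c := by
  have h' : W2sq μ ν < c ^ (2 : ℝ) := by
    rw [← W2_sq, ← ENNReal.rpow_natCast]
    exact ENNReal.rpow_lt_rpow h (by norm_num)
  obtain ⟨γ, hγ⟩ := iInf_lt_iff.1 h'
  obtain ⟨hm, hγ⟩ := iInf_lt_iff.1 hγ
  refine ⟨γ, hm, ?_⟩
  have := ENNReal.rpow_lt_rpow hγ (by norm_num : (0 : ℝ) < 1 / 2)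
  rwa [← ENNReal.rpow_mul, show (2 : ℝ) * (1 / 2) = 1 by norm_num, ENNReal.rpow_one] at this

variable [BorelSpace X] [SecondCountableTopology X]

theorem measurable_edist_sq : Measurable fun p : X × X => edist p.1 p.2 ^ 2 :=
  (measurable_fst.edist measurable_snd).pow_const 2

theorem W2sq_comm (μ ν : Measure X) : W2sq μ ν = W2sq ν μ := by
  have key : ∀ μ ν : Measure X, W2sq μ ν ≤ W2sq ν μ := fun μ ν => le_iInf₂ fun γ hγ => by
    refine (W2sq_le_of_mem (swap_mem_couplings hγ)).trans_eq ?_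
    rw [lintegral_map measurable_edist_sq measurable_swap]
    simp [edist_comm]
  exact le_antisymm (key _ _) (key _ _)

theorem W2_comm (μ ν : Measure X) : W2 μ ν = W2 ν μ := by rw [W2, W2sq_comm, W2]

theorem W2sq_map_map_le {Ω : Type*} [MeasurableSpace Ω] (ρ : Measure Ω) {f g : Ω → X}
    (hf : Measurable f) (hg : Measurable g) :
    W2sq (ρ.map f) (ρ.map g) ≤ ∫⁻ x, edist (f x) (g x) ^ 2 ∂ρ := by
  have hfg := hf.prodMk hg
  refine (W2sq_le_of_mem (γ := ρ.map fun x => (f x, g x)) ⟨?_, ?_⟩).trans_eq ?_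
  · rw [Measure.map_map measurable_fst hfg]; rfl
  · rw [Measure.map_map measurable_snd hfg]; rfl
  · rw [lintegral_map measurable_edist_sq hfg]

theorem W2_self (μ : Measure X) : W2 μ μ = 0 := by
  have := W2sq_map_map_le μ (f := (id : X → X)) measurable_id measurable_id
  have h : W2sq μ μ = 0 := by simpa using this
  simp [W2, h]

/-- Near-optimal couplings, each within ε/2, are glued and Minkowski is applied on the triple
product; no minimizer is needed. -/
theorem W2_triangle [StandardBorelSpace X] [Nonempty X] (μ ν ρ : Measure X)
    [IsProbabilityMeasure μ] [IsProbabilityMeasure ν] :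
    W2 μ ρ ≤ W2 μ ν + W2 ν ρ := by
  refine ENNReal.le_of_forall_pos_le_add fun ε hε hfin => ?_
  obtain ⟨h1, h2⟩ := ENNReal.add_lt_top.1 hfin
  have hε' : ((ε / 2 : ℝ≥0) : ℝ≥0∞) ≠ 0 := by simpa using hε.ne'
  obtain ⟨γ₁, hγ₁, hl₁⟩ := exists_coupling_lt (ENNReal.lt_add_right h1.ne hε')
  obtain ⟨γ₂, hγ₂, hl₂⟩ := exists_coupling_lt (ENNReal.lt_add_right h2.ne hε')
  obtain ⟨Γ, hΓ₁, hΓ₂⟩ := exists_gluing hγ₁ hγ₂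
  have hm₂ : Measurable fun q : (X × X) × X => (q.1.2, q.2) := by fun_prop
  have hm₃ : Measurable fun q : (X × X) × X => (q.1.1, q.2) := by fun_prop
  have hc : Γ.map (fun q => (q.1.1, q.2)) ∈ couplings μ ρ := by
    refine ⟨?_, ?_⟩
    · rw [Measure.map_map measurable_fst hm₃, ← hγ₁.1, ← hΓ₁,
        Measure.map_map measurable_fst measurable_fst]; rfl
    · rw [Measure.map_map measurable_snd hm₃, ← hγ₂.2, ← hΓ₂,
        Measure.map_map measurable_snd hm₂]; rfl
  have e₁ : Measurable fun q : (X × X) × X => edist q.1.1 q.1.2 :=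
    measurable_fst.fst.edist measurable_fst.snd
  have e₂ : Measurable fun q : (X × X) × X => edist q.1.2 q.2 :=
    measurable_fst.snd.edist measurable_snd
  calc W2 μ ρ ≤ (∫⁻ q, edist q.1.1 q.2 ^ 2 ∂Γ) ^ (1 / 2 : ℝ) := by
        refine (W2_le_of_mem hc).trans_eq ?_
        rw [lintegral_map measurable_edist_sq hm₃]
    _ ≤ (∫⁻ q, ((fun q : (X × X) × X => edist q.1.1 q.1.2) + fun q : (X × X) × X => edist q.1.2 q.2) q
          ^ (2 : ℝ) ∂Γ) ^ (1 / 2 : ℝ) := by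
        refine ENNReal.rpow_le_rpow (lintegral_mono fun q => ?_) (by norm_num)
        simp only [Pi.add_apply, ENNReal.rpow_ofNat]
        gcongr
        exact edist_triangle _ _ _
    _ ≤ _ := ENNReal.lintegral_Lp_add_le e₁.aemeasurable e₂.aemeasurable (by norm_num)
    _ = (∫⁻ p, edist p.1 p.2 ^ 2 ∂γ₁) ^ (1 / 2 : ℝ)
          + (∫⁻ p, edist p.1 p.2 ^ 2 ∂γ₂) ^ (1 / 2 : ℝ) := by
        rw [← hΓ₁, ← hΓ₂, lintegral_map measurable_edist_sq measurable_fst,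
          lintegral_map measurable_edist_sq hm₂]
        simp only [ENNReal.rpow_ofNat]
    _ ≤ (W2 μ ν + (ε / 2 : ℝ≥0)) + (W2 ν ρ + (ε / 2 : ℝ≥0)) := add_le_add hl₁.le hl₂.le
    _ = W2 μ ν + W2 ν ρ + ε := by
        rw [add_add_add_comm, ← ENNReal.coe_add, add_halves]

end Wasserstein

/-! ### Zero Wasserstein distance implies equality -/

theorem lintegral_le_rpow_lintegral_sq {Ω : Type*} [MeasurableSpace Ω] (μ : Measure Ω)
    [IsProbabilityMeasure μ] {f : Ω → ℝ≥0∞} (hf : Measurable f) :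
    ∫⁻ x, f x ∂μ ≤ (∫⁻ x, f x ^ 2 ∂μ) ^ (1 / 2 : ℝ) := by
  have h := ENNReal.lintegral_mul_le_Lp_mul_Lq μ (p := 2) (q := 2) (by constructor <;> norm_num)
    hf.aemeasurable (g := fun _ => 1) aemeasurable_const
  simpa using h

/-- The map x ↦ exp(itx) is |t|-Lipschitz, so every coupling bounds the difference by |t| times its
L¹ cost, hence by |t| times its L² cost. -/
theorem enorm_charFun_sub_le (μ ν : Measure ℝ) [IsProbabilityMeasure μ] [IsProbabilityMeasure ν]
    (t : ℝ) : ‖charFun μ t - charFun ν t‖ₑ ≤ ‖t‖ₑ * W2 μ ν := by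
  refine le_of_forall_gt_imp_ge_of_dense fun c hc => ?_
  rcases eq_or_ne t 0 with rfl | ht
  · simp
  have ht0 : ‖t‖ₑ ≠ 0 := by simpa using ht
  have hlt : W2 μ ν < c / ‖t‖ₑ := by
    rw [ENNReal.lt_div_iff_mul_lt (.inl ht0) (.inl enorm_ne_top), mul_comm]; exact hc
  obtain ⟨γ, hγ, hl⟩ := exists_coupling_lt hlt
  have := couplings_isProbabilityMeasure hγ
  have hcont : ∀ x : ℝ, ‖Complex.exp (t * x * Complex.I)‖ = 1 := fun x => by
    rw [← Complex.ofReal_mul, Complex.norm_exp_ofReal_mul_I]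
  have hi1 : Integrable (fun p : ℝ × ℝ => Complex.exp (t * p.1 * Complex.I)) γ :=
    (integrable_const (1 : ℝ)).mono' (by fun_prop) (.of_forall fun p => (hcont _).le)
  have hi2 : Integrable (fun p : ℝ × ℝ => Complex.exp (t * p.2 * Complex.I)) γ :=
    (integrable_const (1 : ℝ)).mono' (by fun_prop) (.of_forall fun p => (hcont _).le)
  have heq : charFun μ t - charFun ν t = ∫ p : ℝ × ℝ, (Complex.exp (t * p.1 * Complex.I)
      - Complex.exp (t * p.2 * Complex.I)) ∂γ := by
    rw [integral_sub hi1 hi2, charFun_apply_real, charFun_apply_real]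
    congr 1
    · rw [← hγ.1, integral_map (by fun_prop) (by fun_prop)]
    · rw [← hγ.2, integral_map (by fun_prop) (by fun_prop)]
  have hpt : ∀ p : ℝ × ℝ, ‖Complex.exp (t * p.1 * Complex.I)
      - Complex.exp (t * p.2 * Complex.I)‖ₑ ≤ ‖t‖ₑ * edist p.1 p.2 := fun p => by
    rw [edist_eq_enorm_sub, ← enorm_mul, enorm_le_iff_norm_le]
    have h1 : Complex.exp (t * p.1 * Complex.I) - Complex.exp (t * p.2 * Complex.I)
        = Complex.exp (t * p.2 * Complex.I)
          * (Complex.exp (Complex.I * ((t * (p.1 - p.2) : ℝ) : ℂ)) - 1) := by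
      rw [mul_sub, ← Complex.exp_add]; push_cast; ring_nf
    rw [h1, norm_mul, hcont, one_mul]
    exact Real.norm_exp_I_mul_ofReal_sub_one_le
  calc ‖charFun μ t - charFun ν t‖ₑ ≤ ∫⁻ p, ‖t‖ₑ * edist p.1 p.2 ∂γ := by
        rw [heq]
        exact (enorm_integral_le_lintegral_enorm _).trans (lintegral_mono hpt)
    _ = ‖t‖ₑ * ∫⁻ p, edist p.1 p.2 ∂γ :=
        lintegral_const_mul _ (measurable_fst.edist measurable_snd)
    _ ≤ ‖t‖ₑ * (c / ‖t‖ₑ) := by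
        gcongr
        exact (lintegral_le_rpow_lintegral_sq γ (measurable_fst.edist measurable_snd)).trans hl.le
    _ ≤ c := ENNReal.mul_div_le

theorem eq_of_W2_eq_zero {μ ν : Measure ℝ} [IsProbabilityMeasure μ] [IsProbabilityMeasure ν]
    (h : W2 μ ν = 0) : μ = ν := by
  refine Measure.ext_of_charFun (funext fun t => ?_)
  have := enorm_charFun_sub_le μ ν t
  rwa [h, mul_zero, nonpos_iff_eq_zero, enorm_eq_zero, sub_eq_zero] at this

/-! ### Wasserstein distance between Gaussians on the line -/

section Gaussian

theorem gaussianReal_eq_map_standard (a σ : ℝ) :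
    gaussianReal a (σ ^ 2).toNNReal = (gaussianReal 0 1).map (fun x => a + σ * x) := by
  have : (fun x : ℝ => a + σ * x) = (a + ·) ∘ (σ * ·) := rfl
  rw [this, ← Measure.map_map (by fun_prop) (by fun_prop), gaussianReal_map_const_mul,
    gaussianReal_map_const_add]
  simp
  congr 1
  ext
  simp [sq_nonneg]

theorem integral_sub_sq_gaussianReal (a σ : ℝ) :
    ∫ x, (x - a) ^ 2 ∂(gaussianReal a (σ ^ 2).toNNReal) = σ ^ 2 := by
  have h := variance_fun_id_gaussianReal (μ := a) (v := (σ ^ 2).toNNReal)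
  rw [variance_eq_integral (by fun_prop)] at h
  simpa [sq_nonneg] using h

/-- The upper bound drives both Gaussians by one standard normal variable. The lower bound is
Kantorovich duality with explicit quadratic potentials. -/
theorem W2sq_gaussianReal {a b σ τ : ℝ} (hσ : 0 < σ) (hτ : 0 < τ) :
    W2sq (gaussianReal a (σ ^ 2).toNNReal) (gaussianReal b (τ ^ 2).toNNReal)
      = ENNReal.ofReal ((a - b) ^ 2 + (σ - τ) ^ 2) := by
  have hedist : ∀ x y : ℝ, edist x y ^ 2 = ENNReal.ofReal ((x - y) ^ 2) := fun x y => by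
    rw [edist_dist, ← ENNReal.ofReal_pow dist_nonneg, Real.dist_eq, sq_abs]
  have hL2 : ∀ (c s : ℝ), MemLp (fun x : ℝ => x - c) 2 (gaussianReal c (s ^ 2).toNNReal) :=
    fun c s => (memLp_id_gaussianReal 2).sub (memLp_const c)
  have hI : ∀ (c s : ℝ), ∫ x, (x - c) ∂(gaussianReal c (s ^ 2).toNNReal) = 0 := fun c s => by
    have h := integral_sub ((memLp_id_gaussianReal 1 (μ := c) (v := (s ^ 2).toNNReal)).integrable
      le_rfl) (integrable_const c)
    simpa using h
  apply le_antisymm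
  · rw [gaussianReal_eq_map_standard a, gaussianReal_eq_map_standard b]
    refine (W2sq_map_map_le _ (by fun_prop) (by fun_prop)).trans_eq ?_
    simp_rw [hedist]
    have hx2 : Integrable (fun x : ℝ => x ^ 2) (gaussianReal 0 1) :=
      (memLp_id_gaussianReal 2).integrable_sq
    have hx1 : Integrable (fun x : ℝ => x) (gaussianReal 0 1) :=
      (memLp_id_gaussianReal 1).integrable le_rfl
    have hlin : Integrable (fun x : ℝ => (a - b) ^ 2 + 2 * (a - b) * (σ - τ) * x)
        (gaussianReal 0 1) := (integrable_const _).add (hx1.const_mul _)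
    have hexp : ∀ x : ℝ, (a + σ * x - (b + τ * x)) ^ 2
        = (a - b) ^ 2 + 2 * (a - b) * (σ - τ) * x + (σ - τ) ^ 2 * x ^ 2 := fun x => by ring
    simp_rw [hexp]
    rw [← ofReal_integral_eq_lintegral_ofReal]
    · have h2 : ∫ x, x ^ 2 ∂(gaussianReal 0 1) = 1 := by
        simpa using integral_sub_sq_gaussianReal 0 1
      rw [integral_add hlin (hx2.const_mul _),
        integral_add (integrable_const _) (hx1.const_mul _),
        integral_const_mul, integral_const_mul, h2]
      simp
    · exact hlin.add (hx2.const_mul _)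
    · exact .of_forall fun x => (sq_nonneg _).trans_eq (hexp x)
  · refine le_iInf₂ fun γ hγ => ?_
    have := couplings_isProbabilityMeasure hγ
    have h1 : MemLp (fun p : ℝ × ℝ => p.1 - a) 2 γ :=
      (hγ.1 ▸ hL2 a σ).comp_of_map measurable_fst.aemeasurable
    have h2 : MemLp (fun p : ℝ × ℝ => p.2 - b) 2 γ :=
      (hγ.2 ▸ hL2 b τ).comp_of_map measurable_snd.aemeasurable
    have i1 := h1.integrable one_le_two
    have i2 := h2.integrable one_le_two
    have s1 := h1.integrable_sq
    have s2 := h2.integrable_sq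
    have v1 : ∫ p : ℝ × ℝ, (p.1 - a) ∂γ = 0 := by
      rw [← hI a σ, ← hγ.1, integral_map (by fun_prop) (by fun_prop)]
    have v2 : ∫ p : ℝ × ℝ, (p.2 - b) ∂γ = 0 := by
      rw [← hI b τ, ← hγ.2, integral_map (by fun_prop) (by fun_prop)]
    have w1 : ∫ p : ℝ × ℝ, (p.1 - a) ^ 2 ∂γ = σ ^ 2 := by
      rw [← integral_sub_sq_gaussianReal a σ, ← hγ.1, integral_map (by fun_prop) (by fun_prop)]
    have w2 : ∫ p : ℝ × ℝ, (p.2 - b) ^ 2 ∂γ = τ ^ 2 := by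
      rw [← integral_sub_sq_gaussianReal b τ, ← hγ.2, integral_map (by fun_prop) (by fun_prop)]
    have j1 : Integrable (fun p : ℝ × ℝ => (a - b) ^ 2 + 2 * (a - b) * (p.1 - a)) γ :=
      (integrable_const _).add (i1.const_mul _)
    have j2 : Integrable (fun p : ℝ × ℝ => (a - b) ^ 2 + 2 * (a - b) * (p.1 - a)
        - 2 * (a - b) * (p.2 - b)) γ := j1.sub (i2.const_mul _)
    have j3 : Integrable (fun p : ℝ × ℝ => (a - b) ^ 2 + 2 * (a - b) * (p.1 - a)
        - 2 * (a - b) * (p.2 - b) + (1 - τ / σ) * (p.1 - a) ^ 2) γ := j2.add (s1.const_mul _)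
    have j4 := s2.const_mul (1 - σ / τ)
    -- The integrand is a function of `p.1` plus a function of `p.2`, so its integral depends only
    -- on the marginals.
    have key : ∫ p : ℝ × ℝ, ((a - b) ^ 2 + 2 * (a - b) * (p.1 - a) - 2 * (a - b) * (p.2 - b)
        + (1 - τ / σ) * (p.1 - a) ^ 2 + (1 - σ / τ) * (p.2 - b) ^ 2) ∂γ
        = (a - b) ^ 2 + (σ - τ) ^ 2 := by
      rw [integral_add j3 j4, integral_add j2 (s1.const_mul _), integral_sub j1 (i2.const_mul _),
        integral_add (integrable_const _) (i1.const_mul _)]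
      simp only [integral_const_mul, v1, v2, w1, w2]
      simp
      field_simp
      ring
    have hsub : Integrable (fun p : ℝ × ℝ => (p.1 - p.2) ^ 2) γ := by
      have := ((h1.sub h2).add (memLp_const (a - b))).integrable_sq
      refine this.congr (.of_forall fun p => ?_)
      simp only [Pi.add_apply, Pi.sub_apply]
      ring
    simp_rw [hedist]
    rw [← ofReal_integral_eq_lintegral_ofReal hsub (.of_forall fun p => sq_nonneg _), ← key]
    refine ENNReal.ofReal_le_ofReal (integral_mono (j3.add j4) hsub fun p => ?_)
    -- The gap between cost and potentials; it vanishes exactly on the graph of the affine map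
    -- coupling the two Gaussians.
    have : 0 ≤ (τ * (p.1 - a) - σ * (p.2 - b)) ^ 2 / (σ * τ) := by positivity
    have e : (p.1 - p.2) ^ 2 = ((a - b) ^ 2 + 2 * (a - b) * (p.1 - a) - 2 * (a - b) * (p.2 - b)
        + (1 - τ / σ) * (p.1 - a) ^ 2 + (1 - σ / τ) * (p.2 - b) ^ 2)
        + (τ * (p.1 - a) - σ * (p.2 - b)) ^ 2 / (σ * τ) := by field_simp; ring
    linarith

theorem W2_gaussianReal {a b σ τ : ℝ} (hσ : 0 < σ) (hτ : 0 < τ) :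
    W2 (gaussianReal a (σ ^ 2).toNNReal) (gaussianReal b (τ ^ 2).toNNReal)
      = ENNReal.ofReal (√((a - b) ^ 2 + (σ - τ) ^ 2)) := by
  rw [W2, W2sq_gaussianReal hσ hτ, ENNReal.ofReal_rpow_of_nonneg (by positivity) (by norm_num),
    Real.sqrt_eq_rpow]

end Gaussian

/-! ### Slicing rays and their Busemann functions -/

section SlicingRay

theorem slicingRay_eq (m₁ t : ℝ) :
    slicingRay m₁ t = gaussianReal (t * m₁) ((1 + t * √(1 - m₁ ^ 2)) ^ 2).toNNReal := by
  rw [slicingRay, gaussianCurve]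
  congr 3 <;> ring

theorem sq_add_sqrt_one_sub_sq {m₁ : ℝ} (h : m₁ ∈ Icc (-1 : ℝ) 1) :
    m₁ ^ 2 + √(1 - m₁ ^ 2) ^ 2 = 1 := by
  rw [Real.sq_sqrt (by nlinarith [h.1, h.2])]
  ring

theorem W2_slicingRay {m₁ : ℝ} (h : m₁ ∈ Icc (-1 : ℝ) 1) {s t : ℝ} (hs : 0 ≤ s) (ht : 0 ≤ t) :
    W2 (slicingRay m₁ s) (slicingRay m₁ t) = ENNReal.ofReal |s - t| := by
  rw [slicingRay_eq, slicingRay_eq, W2_gaussianReal (by positivity) (by positivity)]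
  congr 1
  rw [← Real.sqrt_sq_eq_abs]
  congr 1
  linear_combination (s - t) ^ 2 * sq_add_sqrt_one_sub_sq h

theorem W2_slicingRay_zero_one {m₁ : ℝ} (h : m₁ ∈ Icc (-1 : ℝ) 1) :
    W2 (slicingRay m₁ 0) (slicingRay m₁ 1) = 1 := by
  rw [W2_slicingRay h le_rfl zero_le_one]; simp

theorem isGeodesicRay_slicingRay {m₁ : ℝ} (h : m₁ ∈ Icc (-1 : ℝ) 1) :
    IsGeodesicRay (slicingRay m₁) := fun s t hs ht => by
  rw [W2_slicingRay_zero_one h, mul_one, W2_slicingRay h hs ht]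

/-- The Busemann function of the Euclidean ray in direction `(a, b)`, at the point `(m, s)`. -/
theorem tendsto_sqrt_sub_atTop {a b : ℝ} (hab : a ^ 2 + b ^ 2 = 1) (m s : ℝ) :
    Tendsto (fun t : ℝ => √((t * a - m) ^ 2 + (t * b - s) ^ 2) - t) atTop
      (𝓝 (-(a * m + b * s))) := by
  -- `c` and `e` are the components of (m, s) along the ray and orthogonal to it; the distance is
  -- squeezed between t - c and t - c + e²/(t - c).
  set c := a * m + b * s
  set e := a * s - b * m
  have hexp : ∀ t : ℝ, (t * a - m) ^ 2 + (t * b - s) ^ 2 = (t - c) ^ 2 + e ^ 2 := fun t => by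
    simp only [c, e]
    linear_combination (t ^ 2 - m ^ 2 - s ^ 2) * hab
  have hup : Tendsto (fun t : ℝ => -c + e ^ 2 / (t - c)) atTop (𝓝 (-c)) := by
    have : Tendsto (fun t : ℝ => t - c) atTop atTop :=
      tendsto_atTop_add_const_right _ _ tendsto_id
    simpa using tendsto_const_nhds.add (this.const_div_atTop (e ^ 2))
  refine tendsto_of_tendsto_of_tendsto_of_le_of_le' tendsto_const_nhds hup ?_ ?_
  · filter_upwards with t
    rw [hexp]
    have : t - c ≤ √((t - c) ^ 2 + e ^ 2) := Real.le_sqrt_of_sq_le (by nlinarith [sq_nonneg e])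
    linarith
  · filter_upwards [eventually_gt_atTop c] with t ht
    have hu : 0 < t - c := sub_pos.2 ht
    rw [hexp]
    have : √((t - c) ^ 2 + e ^ 2) ≤ (t - c) + e ^ 2 / (t - c) := by
      refine Real.sqrt_le_iff.2 ⟨by positivity, ?_⟩
      have h1 : ((t - c) + e ^ 2 / (t - c)) ^ 2
          = (t - c) ^ 2 + e ^ 2 + e ^ 2 + (e ^ 2 / (t - c)) ^ 2 := by field_simp; ring
      rw [h1]
      nlinarith [sq_nonneg e, sq_nonneg (e ^ 2 / (t - c))]
    linarith

theorem tendsto_busemannApprox_gaussianReal {m₁ : ℝ} (h : m₁ ∈ Icc (-1 : ℝ) 1) (m : ℝ) {σ : ℝ}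
    (hσ : 0 < σ) :
    Tendsto (busemannApprox (slicingRay m₁) (gaussianReal m (σ ^ 2).toNNReal)) atTop
      (𝓝 (-(m₁ * m + √(1 - m₁ ^ 2) * (σ - 1)))) := by
  -- The shift `σ - 1` appears because the ray starts at standard deviation 1.
  refine (tendsto_sqrt_sub_atTop (sq_add_sqrt_one_sub_sq h) m (σ - 1)).congr' ?_
  filter_upwards [eventually_ge_atTop 0] with t ht
  rw [busemannApprox, W2_slicingRay_zero_one h, slicingRay_eq, W2_gaussianReal (by positivity) hσ,
    ENNReal.toReal_ofReal (Real.sqrt_nonneg _), ENNReal.toReal_one, mul_one]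
  congr 3
  ring

end SlicingRay

/-! ### Projected mixtures and their continuity in the slice -/

section Projection

variable {d : ℕ}

/-- The mean of a Gaussian measure. -/
noncomputable def BW.mean (μ : BW d) : EuclideanSpace ℝ (Fin d) := μ.2.choose

/-- The covariance matrix of a Gaussian measure. -/
noncomputable def BW.cov (μ : BW d) : Matrix (Fin d) (Fin d) ℝ := μ.2.choose_spec.choose

theorem BW.posDef_cov (μ : BW d) : μ.cov.PosDef := μ.2.choose_spec.choose_spec.1

theorem BW.eq_multivariateGaussian (μ : BW d) : μ.1 = multivariateGaussian μ.mean μ.cov :=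
  μ.2.choose_spec.choose_spec.2

/-- The standard deviation of a Gaussian measure in the direction `x`. -/
noncomputable def BW.std (μ : BW d) (x : EuclideanSpace ℝ (Fin d)) : ℝ :=
  √(x.ofLp ⬝ᵥ μ.cov.mulVec x.ofLp)

theorem BW.variance_pos (μ : BW d) {x : EuclideanSpace ℝ (Fin d)} (hx : x ≠ 0) :
    0 < x.ofLp ⬝ᵥ μ.cov.mulVec x.ofLp := by
  have h := μ.posDef_cov.dotProduct_mulVec_pos (x := x.ofLp) (by simpa using hx)
  simpa using h

theorem BW.std_pos (μ : BW d) {x : EuclideanSpace ℝ (Fin d)} (hx : x ≠ 0) : 0 < μ.std x :=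
  Real.sqrt_pos.2 (μ.variance_pos hx)

theorem BW.continuous_std (μ : BW d) : Continuous μ.std := by
  unfold BW.std
  refine Real.continuous_sqrt.comp ?_
  have : Continuous fun x : EuclideanSpace ℝ (Fin d) => x.ofLp := PiLp.continuous_ofLp 2 _
  exact this.dotProduct (continuous_const.matrix_mulVec this)

theorem ne_zero_of_mem_unitSphere (θ : UnitSphere d) : (θ : EuclideanSpace ℝ (Fin d)) ≠ 0 :=
  ne_zero_of_mem_unit_sphere θ

theorem proj_eq_gaussianReal (θ : UnitSphere d) (μ : BW d) :
    proj θ μ = gaussianReal ⟪(θ : EuclideanSpace ℝ (Fin d)), μ.mean⟫ (μ.std θ ^ 2).toNNReal := by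
  have hS := μ.posDef_cov.posSemidef
  rw [proj, μ.eq_multivariateGaussian]
  have hL : (fun x => ⟪(θ : EuclideanSpace ℝ (Fin d)), x⟫)
      = ⇑(innerSL ℝ (θ : EuclideanSpace ℝ (Fin d))) := rfl
  rw [hL, IsGaussian.map_eq_gaussianReal]
  congr 2
  · rw [ContinuousLinearMap.integral_comp_id_comm IsGaussian.integrable_id]
    simp
  · rw [← hL, ← covarianceBilin_self IsGaussian.memLp_two_id,
      covarianceBilin_multivariateGaussian hS, BW.std,
      Real.sq_sqrt (μ.variance_pos (ne_zero_of_mem_unitSphere θ)).le]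

/-- The closed form of the Busemann projection of a Gaussian measure. -/
noncomputable def busemannValue (z : UnitSphere d × ℝ) (μ : BW d) : ℝ :=
  -(z.2 * ⟪(z.1 : EuclideanSpace ℝ (Fin d)), μ.mean⟫ + √(1 - z.2 ^ 2) * (μ.std z.1 - 1))

theorem continuous_busemannValue (μ : BW d) :
    Continuous fun z : UnitSphere d × ℝ => busemannValue z μ := by
  have := μ.continuous_std
  unfold busemannValue
  fun_prop

theorem tendsto_busemannApprox {m₁ : ℝ} (h : m₁ ∈ Icc (-1 : ℝ) 1) (θ : UnitSphere d) (μ : BW d) :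
    Tendsto (busemannApprox (slicingRay m₁) (proj θ μ)) atTop (𝓝 (busemannValue (θ, m₁) μ)) := by
  rw [proj_eq_gaussianReal]
  exact tendsto_busemannApprox_gaussianReal h _ (μ.std_pos (ne_zero_of_mem_unitSphere θ))

theorem busemann_eq {m₁ : ℝ} (h : m₁ ∈ Icc (-1 : ℝ) 1) (θ : UnitSphere d) (μ : BW d) :
    busemann (slicingRay m₁) (proj θ μ) = busemannValue (θ, m₁) μ :=
  (tendsto_busemannApprox h θ μ).limUnder_eq

/-- The projected mixture, in closed form. -/
noncomputable def valueMixture (P : PMF (BW d)) (z : UnitSphere d × ℝ) : Measure ℝ :=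
  (P.map (busemannValue z)).toMeasure

instance (P : PMF (BW d)) (z : UnitSphere d × ℝ) : IsProbabilityMeasure (valueMixture P z) := by
  unfold valueMixture; infer_instance

theorem projMixture_eq {z : UnitSphere d × ℝ} (h : z.2 ∈ Icc (-1 : ℝ) 1) (P : PMF (BW d)) :
    projMixture z.1 z.2 P = valueMixture P z := by
  rw [projMixture, PMF.map_comp, valueMixture]
  congr 2
  exact funext fun μ => busemann_eq h z.1 μ

theorem valueMixture_map {K : ℕ} (α : PMF (Fin K)) (μ : Fin K → BW d) (z : UnitSphere d × ℝ) :
    valueMixture (α.map μ) z = α.toMeasure.map fun k => busemannValue z (μ k) := by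
  rw [valueMixture, PMF.map_comp]
  exact (PMF.toMeasure_map _ α (measurable_of_finite _)).symm

theorem mem_finiteGMM_iff {P : PMF (BW d)} :
    P ∈ finiteGMM d ↔ ∃ K > 0, ∃ (α : PMF (Fin K)) (μ : Fin K → BW d), P = α.map μ := by
  simp [finiteGMM, GMM]

/-- The weights do not depend on the slice, so the same component index can drive both measures; the
cost is a finite sum continuous in the slice. -/
theorem tendsto_W2_valueMixture {P : PMF (BW d)} (hP : P ∈ finiteGMM d) (z : UnitSphere d × ℝ) :
    Tendsto (fun w => W2 (valueMixture P w) (valueMixture P z)) (𝓝 z) (𝓝 0) := by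
  obtain ⟨K, -, α, μ, rfl⟩ := mem_finiteGMM_iff.1 hP
  have hF : Tendsto (fun w => (∫⁻ k, edist (busemannValue w (μ k)) (busemannValue z (μ k)) ^ 2
      ∂α.toMeasure) ^ (1 / 2 : ℝ)) (𝓝 z) (𝓝 0) := by
    simp_rw [lintegral_fintype]
    have hc : Continuous fun w => (∑ k, edist (busemannValue w (μ k)) (busemannValue z (μ k)) ^ 2
        * α.toMeasure {k}) ^ (1 / 2 : ℝ) := by
      refine ENNReal.continuous_rpow_const.comp (continuous_finsetSum _ fun k _ => ?_)
      exact (ENNReal.continuous_mul_const (measure_ne_top _ _)).comp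
        ((ENNReal.continuous_pow 2).comp
          ((continuous_busemannValue (μ k)).edist continuous_const))
    have := hc.tendsto z
    simpa using this
  refine tendsto_of_tendsto_of_tendsto_of_le_of_le tendsto_const_nhds hF (fun _ => zero_le)
    fun w => ?_
  simp only [valueMixture_map]
  exact ENNReal.rpow_le_rpow (W2sq_map_map_le _ (measurable_of_finite _)
    (measurable_of_finite _)) (by norm_num)

/-- Drawing the two component indices independently gives a coupling whose cost is a finite sum of
finite terms. -/
theorem W2_valueMixture_lt_top {P Q : PMF (BW d)} (hP : P ∈ finiteGMM d) (hQ : Q ∈ finiteGMM d)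
    (z : UnitSphere d × ℝ) : W2 (valueMixture P z) (valueMixture Q z) < ∞ := by
  obtain ⟨K, -, α, μ, rfl⟩ := mem_finiteGMM_iff.1 hP
  obtain ⟨L, -, β, ν, rfl⟩ := mem_finiteGMM_iff.1 hQ
  refine ENNReal.rpow_lt_top_of_nonneg (by norm_num) (ne_top_of_le_ne_top ?_ (b :=
    ∫⁻ p, edist (busemannValue z (μ p.1)) (busemannValue z (ν p.2)) ^ 2
      ∂(α.toMeasure.prod β.toMeasure)) ?_)
  · rw [lintegral_fintype]
    exact ENNReal.sum_ne_top.2 fun p _ =>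
      ENNReal.mul_ne_top (ENNReal.pow_ne_top (edist_ne_top _ _)) (measure_ne_top _ _)
  · have h := W2sq_map_map_le (α.toMeasure.prod β.toMeasure)
      (f := fun p => busemannValue z (μ p.1)) (g := fun p => busemannValue z (ν p.2))
      (measurable_of_finite _) (measurable_of_finite _)
    refine le_of_eq_of_le ?_ h
    rw [valueMixture_map, valueMixture_map]
    congr 1
    · conv_lhs => rw [← Measure.fst_prod (μ := α.toMeasure) (ν := β.toMeasure)]
      exact Measure.map_map (measurable_of_finite _) measurable_fst
    · conv_lhs => rw [← Measure.snd_prod (μ := α.toMeasure) (ν := β.toMeasure)]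
      exact Measure.map_map (measurable_of_finite _) measurable_snd

theorem continuous_W2_valueMixture {P Q : PMF (BW d)} (hP : P ∈ finiteGMM d)
    (hQ : Q ∈ finiteGMM d) : Continuous fun z => W2 (valueMixture P z) (valueMixture Q z) := by
  refine continuous_iff_continuousAt.2 fun z => ?_
  have hδ := (tendsto_W2_valueMixture hP z).add (tendsto_W2_valueMixture hQ z)
  rw [add_zero] at hδ
  have hfin := (W2_valueMixture_lt_top hP hQ z).ne
  have hlow := ENNReal.Tendsto.sub (tendsto_const_nhds (x := W2 (valueMixture P z)
    (valueMixture Q z))) hδ (.inl hfin)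
  have hup := (tendsto_const_nhds (x := W2 (valueMixture P z) (valueMixture Q z))).add hδ
  rw [tsub_zero] at hlow
  rw [add_zero] at hup
  refine tendsto_of_tendsto_of_tendsto_of_le_of_le hlow hup (fun w => ?_) fun w => ?_
  · refine tsub_le_iff_right.2 ?_
    calc W2 (valueMixture P z) (valueMixture Q z)
        ≤ W2 (valueMixture P z) (valueMixture P w) + (W2 (valueMixture P w) (valueMixture Q w)
          + W2 (valueMixture Q w) (valueMixture Q z)) :=
          (W2_triangle _ _ _).trans (add_le_add_right (W2_triangle _ _ _) _)
      _ = _ := by rw [W2_comm (valueMixture P z)]; ring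
  · calc W2 (valueMixture P w) (valueMixture Q w)
        ≤ W2 (valueMixture P w) (valueMixture P z) + (W2 (valueMixture P z) (valueMixture Q z)
          + W2 (valueMixture Q z) (valueMixture Q w)) :=
          (W2_triangle _ _ _).trans (add_le_add_right (W2_triangle _ _ _) _)
      _ = _ := by rw [W2_comm (valueMixture Q z)]; ring

end Projection

/-! ### Slices that separate finitely many Gaussians -/

theorem eq_of_map_eq_of_injOn {α β : Type*} {P Q : PMF α} {f : α → β} {A : Set α}
    (hf : InjOn f A) (hP : P.support ⊆ A) (hQ : Q.support ⊆ A) (h : P.map f = Q.map f) :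
    P = Q := by
  have key : ∀ R : PMF α, R.support ⊆ A → ∀ x ∈ A, R.map f (f x) = R x := fun R hR x hx => by
    rw [PMF.map_apply, tsum_eq_single x, if_pos rfl]
    intro y hy
    by_cases hyR : y ∈ R.support
    · rw [if_neg fun e => hy (hf (hR hyR) hx e.symm)]
    · simp [(PMF.apply_eq_zero_iff _ _).2 hyR]
  ext x
  by_cases hx : x ∈ A
  · rw [← key P hP x hx, ← key Q hQ x hx, h]
  · rw [(PMF.apply_eq_zero_iff _ _).2 fun h => hx (hP h),
      (PMF.apply_eq_zero_iff _ _).2 fun h => hx (hQ h)]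

section GenericDirection

variable {d : ℕ}

/-- By polarization, a symmetric operator with vanishing quadratic form is zero. -/
theorem exists_quadraticForm_ne_zero {S : Matrix (Fin d) (Fin d) ℝ} (hS : S.IsHermitian)
    (h0 : S ≠ 0) : ∃ x : Fin d → ℝ, x ⬝ᵥ S.mulVec x ≠ 0 := by
  by_contra! h
  refine h0 ?_
  have hsymm := Matrix.isSymmetric_toEuclideanLin_iff.2 hS
  have hz := hsymm.inner_map_self_eq_zero.1 fun x => by
    have := h x.ofLp
    rw [real_inner_comm]
    simpa [Matrix.toLpLin_apply, EuclideanSpace.inner_eq_star_dotProduct,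
      dotProduct_comm] using this
  simpa using hz

/-- A polynomial on `ℝ^d` that is positive in the directions in which the projections of `μ` and
`ν` have different means or different variances. -/
noncomputable def separatingPolynomial (μ ν : BW d) : MvPolynomial (Fin d) ℝ :=
  (∑ i, MvPolynomial.C ((μ.mean - ν.mean) i) * MvPolynomial.X i) ^ 2
    + (∑ i, ∑ j, MvPolynomial.X i * (MvPolynomial.C ((μ.cov - ν.cov) i j) * MvPolynomial.X j)) ^ 2

theorem eval_separatingPolynomial (μ ν : BW d) (x : EuclideanSpace ℝ (Fin d)) :
    MvPolynomial.eval x.ofLp (separatingPolynomial μ ν)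
      = ⟪x, μ.mean - ν.mean⟫ ^ 2 + (x.ofLp ⬝ᵥ (μ.cov - ν.cov).mulVec x.ofLp) ^ 2 := by
  simp [separatingPolynomial, PiLp.inner_apply, dotProduct, Matrix.mulVec, Finset.mul_sum]

theorem separatingPolynomial_ne_zero {μ ν : BW d} (h : μ ≠ ν) : separatingPolynomial μ ν ≠ 0 := by
  intro h0
  have hev : ∀ x : EuclideanSpace ℝ (Fin d),
      ⟪x, μ.mean - ν.mean⟫ ^ 2 + (x.ofLp ⬝ᵥ (μ.cov - ν.cov).mulVec x.ofLp) ^ 2 = 0 := fun x => by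
    rw [← eval_separatingPolynomial, h0, map_zero]
  have hmean : μ.mean = ν.mean := by
    have h1 : ⟪μ.mean - ν.mean, μ.mean - ν.mean⟫ = 0 := by
      have := hev (μ.mean - ν.mean)
      nlinarith [sq_nonneg ⟪μ.mean - ν.mean, μ.mean - ν.mean⟫, sq_nonneg ((μ.mean - ν.mean).ofLp ⬝ᵥ
        (μ.cov - ν.cov).mulVec (μ.mean - ν.mean).ofLp)]
    exact sub_eq_zero.1 (inner_self_eq_zero.1 h1)
  have hcov : μ.cov = ν.cov := by
    by_contra hne
    obtain ⟨x, hx⟩ := exists_quadraticForm_ne_zero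
      (μ.posDef_cov.isHermitian.sub ν.posDef_cov.isHermitian) (sub_ne_zero.2 hne)
    have := hev (WithLp.toLp 2 x)
    have hpos : 0 < (x ⬝ᵥ (μ.cov - ν.cov).mulVec x) ^ 2 := by positivity
    simp only at this
    nlinarith [sq_nonneg ⟪WithLp.toLp 2 x, μ.mean - ν.mean⟫]
  -- Only this implication is needed: uniqueness of the parameters of a Gaussian is never used.
  exact h (Subtype.ext (by
    rw [μ.eq_multivariateGaussian, ν.eq_multivariateGaussian, hmean, hcov]))

theorem exists_separating_direction (hd : 0 < d) (A : Finset (BW d)) :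
    ∃ θ : UnitSphere d, ∀ μ ∈ A, ∀ ν ∈ A, μ ≠ ν →
      ⟪(θ : EuclideanSpace ℝ (Fin d)), μ.mean - ν.mean⟫ ≠ 0 ∨ μ.std θ - ν.std θ ≠ 0 := by
  classical
  -- The factor `X` forces a nonvanishing point to be nonzero, hence normalizable, even when the
  -- product is empty.
  have hp : MvPolynomial.X ⟨0, hd⟩ * ∏ p ∈ A.offDiag, separatingPolynomial p.1 p.2 ≠ 0 :=
    mul_ne_zero (MvPolynomial.X_ne_zero _) (Finset.prod_ne_zero_iff.2 fun p hp =>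
      separatingPolynomial_ne_zero (Finset.mem_offDiag.1 hp).2.2)
  obtain ⟨x, hx⟩ : ∃ x : Fin d → ℝ, MvPolynomial.eval x
      (MvPolynomial.X ⟨0, hd⟩ * ∏ p ∈ A.offDiag, separatingPolynomial p.1 p.2) ≠ 0 := by
    by_contra! h
    exact hp (MvPolynomial.funext fun x => by rw [h x, map_zero])
  rw [map_mul, MvPolynomial.eval_X, map_prod] at hx
  set y : EuclideanSpace ℝ (Fin d) := WithLp.toLp 2 x
  have hy : y ≠ 0 := fun h => left_ne_zero_of_mul hx (by
    have := congrArg (fun v : EuclideanSpace ℝ (Fin d) => v ⟨0, hd⟩) h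
    simpa [y] using this)
  have hn : ‖y‖⁻¹ ≠ 0 := inv_ne_zero (norm_ne_zero_iff.2 hy)
  refine ⟨⟨‖y‖⁻¹ • y, by simp [norm_smul, norm_ne_zero_iff.2 hy]⟩, fun μ hμ ν hν hne => ?_⟩
  have hev := Finset.prod_ne_zero_iff.1 (right_ne_zero_of_mul hx) (μ, ν)
    (Finset.mem_offDiag.2 ⟨hμ, hν, hne⟩)
  have hev' := eval_separatingPolynomial μ ν y
  by_contra! hcon
  obtain ⟨h1, h2⟩ := hcon
  refine hev (hev'.trans ?_)
  have h1' : ⟪y, μ.mean - ν.mean⟫ = 0 := by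
    rw [real_inner_smul_left] at h1
    exact (mul_eq_zero.1 h1).resolve_left hn
  have h2' : y.ofLp ⬝ᵥ (μ.cov - ν.cov).mulVec y.ofLp = 0 := by
    have hne' : ‖y‖⁻¹ • y ≠ 0 := smul_ne_zero hn hy
    -- Equal standard deviations mean equal variances, and homogeneity of the quadratic forms lets
    -- the factors ‖y‖⁻¹ cancel.
    have h3 := (Real.sqrt_inj (μ.variance_pos hne').le (ν.variance_pos hne').le).1
      (sub_eq_zero.1 h2)
    simp only [WithLp.ofLp_smul, Matrix.mulVec_smul, smul_dotProduct, dotProduct_smul,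
      smul_eq_mul] at h3
    have h4 := mul_left_cancel₀ hn (mul_left_cancel₀ hn h3)
    rw [Matrix.sub_mulVec, dotProduct_sub, h4, sub_self]
  rw [h1', h2']
  ring

theorem finite_setOf_mul_add_sqrt_mul_eq_zero {a b : ℝ} (hab : a ≠ 0 ∨ b ≠ 0) :
    {m : ℝ | m ∈ Ioo (-1 : ℝ) 1 ∧ m * a + √(1 - m ^ 2) * b = 0}.Finite := by
  have hpos : 0 < a ^ 2 + b ^ 2 := by
    rcases hab with h | h <;> positivity
  refine (Set.toFinite {√(b ^ 2 / (a ^ 2 + b ^ 2)), -√(b ^ 2 / (a ^ 2 + b ^ 2))}).subset ?_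
  rintro m ⟨hm, h⟩
  have h1 := sq_add_sqrt_one_sub_sq (Ioo_subset_Icc_self hm)
  have h2 : m ^ 2 * (a ^ 2 + b ^ 2) = b ^ 2 := by
    -- Multiplying by the conjugate removes the root and leaves m² determined.
    linear_combination (m * a - √(1 - m ^ 2) * b) * h + b ^ 2 * h1
  have h3 : m ^ 2 = √(b ^ 2 / (a ^ 2 + b ^ 2)) ^ 2 := by
    rw [Real.sq_sqrt (by positivity), eq_div_iff hpos.ne', h2]
  simpa using sq_eq_sq_iff_eq_or_eq_neg.1 h3

theorem exists_injOn_busemannValue (hd : 0 < d) (A : Finset (BW d)) :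
    ∃ z : UnitSphere d × ℝ, z.2 ∈ Ioo (-1 : ℝ) 1 ∧ InjOn (busemannValue z) A := by
  classical
  obtain ⟨θ, hθ⟩ := exists_separating_direction hd A
  have hfin : (⋃ p ∈ A.offDiag, {m : ℝ | m ∈ Ioo (-1 : ℝ) 1 ∧
      m * ⟪(θ : EuclideanSpace ℝ (Fin d)), p.1.mean - p.2.mean⟫
        + √(1 - m ^ 2) * (p.1.std θ - p.2.std θ) = 0}).Finite := by
    refine A.offDiag.finite_toSet.biUnion fun p hp => ?_
    obtain ⟨h1, h2, h3⟩ := Finset.mem_offDiag.1 hp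
    exact finite_setOf_mul_add_sqrt_mul_eq_zero (hθ _ h1 _ h2 h3)
  obtain ⟨m, hm, hm'⟩ := ((Ioo_infinite (by norm_num : (-1 : ℝ) < 1)).sdiff hfin).nonempty
  refine ⟨(θ, m), hm, fun μ hμ ν hν h => ?_⟩
  by_contra hne
  refine hm' (mem_biUnion (x := (μ, ν)) (Finset.mem_offDiag.2 ⟨hμ, hν, hne⟩) ⟨hm, ?_⟩)
  simp only [busemannValue] at h
  simp only [inner_sub_right]
  linear_combination -h

theorem exists_finset_support_subset {P : PMF (BW d)} (hP : P ∈ finiteGMM d) :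
    ∃ A : Finset (BW d), P.support ⊆ A := by
  classical
  obtain ⟨K, -, α, μ, rfl⟩ := mem_finiteGMM_iff.1 hP
  refine ⟨Finset.univ.image μ, ?_⟩
  rw [PMF.support_map]
  rintro _ ⟨k, -, rfl⟩
  simp

end GenericDirection

/-! ### The slicing measure -/

section SlicingMeasure

variable {d : ℕ}

theorem toSphere_univ_ne_zero (hd : 0 < d) :
    (volume : Measure (EuclideanSpace ℝ (Fin d))).toSphere univ ≠ 0 := by
  have : Nonempty (Fin d) := ⟨⟨0, hd⟩⟩
  rw [Measure.measure_univ_ne_zero]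
  exact Measure.toSphere_ne_zero _

theorem isFiniteMeasure_uniformSphere (hd : 0 < d) : IsFiniteMeasure (uniformSphere d) := by
  refine ⟨?_⟩
  rw [uniformSphere, Measure.smul_apply, smul_eq_mul]
  exact ENNReal.mul_lt_top (ENNReal.inv_lt_top.2 (pos_iff_ne_zero.2 (toSphere_univ_ne_zero hd)))
    (measure_lt_top _ _)

theorem uniformInterval_eq :
    uniformInterval = (2 : ℝ≥0∞)⁻¹ • volume.restrict (Icc (-1 : ℝ) 1) := by
  rw [uniformInterval, Real.volume_Icc]
  norm_num

instance : IsFiniteMeasure uniformInterval := by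
  refine ⟨?_⟩
  rw [uniformInterval_eq, Measure.smul_apply, smul_eq_mul]
  exact ENNReal.mul_lt_top (by simp) (measure_lt_top _ _)

theorem isFiniteMeasure_slicingMeasure (hd : 0 < d) : IsFiniteMeasure (slicingMeasure d) := by
  have := isFiniteMeasure_uniformSphere hd
  unfold slicingMeasure
  infer_instance

theorem ae_slicingMeasure_mem_Icc (hd : 0 < d) :
    ∀ᵐ z ∂(slicingMeasure d), z.2 ∈ Icc (-1 : ℝ) 1 := by
  have := isFiniteMeasure_uniformSphere hd
  have h : ∀ᵐ m ∂uniformInterval, m ∈ Icc (-1 : ℝ) 1 := by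
    rw [uniformInterval_eq]
    exact Measure.ae_smul_measure (ae_restrict_mem measurableSet_Icc) _
  exact Measure.quasiMeasurePreserving_snd.ae h

/-- Surface measure and Lebesgue measure charge nonempty open sets; near an interior `z.2`,
restriction to the interval changes nothing. -/
theorem slicingMeasure_pos (hd : 0 < d) {U : Set (UnitSphere d × ℝ)} (hU : IsOpen U)
    {z : UnitSphere d × ℝ} (hz : z ∈ U) (hz' : z.2 ∈ Ioo (-1 : ℝ) 1) :
    0 < slicingMeasure d U := by
  have := isFiniteMeasure_uniformSphere hd
  obtain ⟨V, W, hV, hW, h1, h2, hVW⟩ := isOpen_prod_iff.1 hU z.1 z.2 hz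
  refine lt_of_lt_of_le ?_ (measure_mono ((prod_mono_right inter_subset_left).trans hVW :
    V ×ˢ (W ∩ Ioo (-1 : ℝ) 1) ⊆ U))
  have hW' := hW.inter (isOpen_Ioo (a := (-1 : ℝ)) (b := 1))
  rw [slicingMeasure, Measure.prod_prod]
  refine ENNReal.mul_pos ?_ ?_
  · rw [uniformSphere, Measure.smul_apply, smul_eq_mul]
    exact mul_ne_zero (ENNReal.inv_ne_zero.2 (measure_ne_top _ _)) (hV.measure_pos _ ⟨_, h1⟩).ne'
  · rw [uniformInterval_eq, Measure.smul_apply, smul_eq_mul,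
      Measure.restrict_eq_self _ (inter_subset_right.trans Ioo_subset_Icc_self)]
    exact mul_ne_zero (by simp) (hW'.measure_pos _ ⟨_, h2, hz'⟩).ne'

end SlicingMeasure

/-! ### The distance axioms -/

section Distance

variable {d : ℕ} {P Q R : PMF (BW d)}

theorem W2sq_projMixture_ae_eq (hd : 0 < d) (P Q : PMF (BW d)) :
    (fun z : UnitSphere d × ℝ => W2sq (projMixture z.1 z.2 P) (projMixture z.1 z.2 Q))
      =ᵐ[slicingMeasure d] fun z => W2 (valueMixture P z) (valueMixture Q z) ^ 2 := by
  filter_upwards [ae_slicingMeasure_mem_Icc hd] with z hz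
  rw [projMixture_eq hz, projMixture_eq hz, W2_sq]

theorem aemeasurable_W2sq_projMixture (hd : 0 < d) (hP : P ∈ finiteGMM d) (hQ : Q ∈ finiteGMM d) :
    AEMeasurable (fun z : UnitSphere d × ℝ => W2sq (projMixture z.1 z.2 P)
      (projMixture z.1 z.2 Q)) (slicingMeasure d) :=
  ((continuous_W2_valueMixture hP hQ).measurable.pow_const 2).aemeasurable.congr
    (W2sq_projMixture_ae_eq hd P Q).symm

theorem B1DGMSW_eq (hd : 0 < d) (P Q : PMF (BW d)) :
    B1DGMSW P Q = (∫⁻ z, W2 (valueMixture P z) (valueMixture Q z) ^ 2 ∂(slicingMeasure d))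
      ^ (1 / 2 : ℝ) := by
  rw [B1DGMSW, lintegral_congr_ae (W2sq_projMixture_ae_eq hd P Q)]

theorem B1DGMSW_comm (P Q : PMF (BW d)) : B1DGMSW P Q = B1DGMSW Q P := by
  simp_rw [B1DGMSW, W2sq_comm (projMixture _ _ P)]

theorem B1DGMSW_lt_top (hd : 0 < d) (hP : P ∈ finiteGMM d) (hQ : Q ∈ finiteGMM d) :
    B1DGMSW P Q < ∞ := by
  have := isFiniteMeasure_slicingMeasure hd
  rw [B1DGMSW_eq hd]
  have hK : IsCompact (univ ×ˢ Icc (-1 : ℝ) 1 : Set (UnitSphere d × ℝ)) :=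
    isCompact_univ.prod isCompact_Icc
  obtain ⟨M, hM, hbound⟩ : ∃ M < ∞, ∀ z ∈ (univ ×ˢ Icc (-1 : ℝ) 1 : Set (UnitSphere d × ℝ)),
      W2 (valueMixture P z) (valueMixture Q z) ≤ M := by
    rcases (univ ×ˢ Icc (-1 : ℝ) 1 : Set (UnitSphere d × ℝ)).eq_empty_or_nonempty with he | hne
    · exact ⟨0, by simp, by simp [he]⟩
    · obtain ⟨z, -, hz⟩ := hK.exists_isMaxOn hne (continuous_W2_valueMixture hP hQ).continuousOn
      exact ⟨_, W2_valueMixture_lt_top hP hQ z, fun w hw => hz hw⟩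
  refine ENNReal.rpow_lt_top_of_nonneg (by norm_num) (ne_top_of_le_ne_top
    (b := ∫⁻ _, M ^ 2 ∂(slicingMeasure d)) ?_ (lintegral_mono_ae ?_))
  · rw [lintegral_const]
    exact ENNReal.mul_ne_top (ENNReal.pow_ne_top hM.ne) (measure_ne_top _ _)
  · filter_upwards [ae_slicingMeasure_mem_Icc hd] with z hz
    gcongr
    exact hbound z ⟨mem_univ _, hz⟩

theorem B1DGMSW_triangle (hd : 0 < d) (hP : P ∈ finiteGMM d) (hQ : Q ∈ finiteGMM d)
    (hR : R ∈ finiteGMM d) : B1DGMSW P R ≤ B1DGMSW P Q + B1DGMSW Q R := by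
  have h := ENNReal.lintegral_Lp_add_le (μ := slicingMeasure d)
    (continuous_W2_valueMixture hP hQ).aemeasurable (continuous_W2_valueMixture hQ hR).aemeasurable
    one_le_two
  simp only [Pi.add_apply, ENNReal.rpow_ofNat] at h
  simp only [B1DGMSW_eq hd]
  refine le_trans (ENNReal.rpow_le_rpow (lintegral_mono fun z => ?_) (by norm_num)) h
  gcongr
  exact W2_triangle _ _ _

theorem B1DGMSW_self (hd : 0 < d) (P : PMF (BW d)) : B1DGMSW P P = 0 := by
  simp [B1DGMSW_eq hd, W2_self]

theorem eq_of_B1DGMSW_eq_zero (hd : 0 < d) (hP : P ∈ finiteGMM d) (hQ : Q ∈ finiteGMM d)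
    (h : B1DGMSW P Q = 0) : P = Q := by
  classical
  have hcont := continuous_W2_valueMixture hP hQ
  rw [B1DGMSW_eq hd, ENNReal.rpow_eq_zero_iff_of_pos (by norm_num),
    lintegral_eq_zero_iff (hcont.measurable.pow_const 2)] at h
  obtain ⟨A, hA⟩ := exists_finset_support_subset hP
  obtain ⟨B, hB⟩ := exists_finset_support_subset hQ
  obtain ⟨z, hz, hinj⟩ := exists_injOn_busemannValue hd (A ∪ B)
  have hz0 : W2 (valueMixture P z) (valueMixture Q z) = 0 := by
    by_contra hne
    -- If the continuous distance were nonzero at `z`, it would be nonzero on an open set of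
    -- positive measure.
    have hpos := slicingMeasure_pos hd (isOpen_compl_singleton.preimage hcont
      : IsOpen ((fun z => W2 (valueMixture P z) (valueMixture Q z)) ⁻¹' {0}ᶜ)) hne hz
    refine hpos.ne' (measure_mono_null (fun w hw => ?_) (ae_iff.1 h))
    simpa using hw
  refine eq_of_map_eq_of_injOn hinj (hA.trans (by simp)) (hB.trans (by simp)) ?_
  exact PMF.toMeasure_injective (eq_of_W2_eq_zero hz0)

theorem isDistanceOn_B1DGMSW (hd : 0 < d) : IsDistanceOn (finiteGMM d) B1DGMSW where
  finite _ hP _ hQ := B1DGMSW_lt_top hd hP hQ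
  eq_zero_iff _ hP _ hQ :=
    ⟨eq_of_B1DGMSW_eq_zero hd hP hQ, fun h => h ▸ B1DGMSW_self hd _⟩
  symm _ _ _ _ := B1DGMSW_comm _ _
  triangle _ hP _ hQ _ hR := B1DGMSW_triangle hd hP hQ hR

end Distance

end BusemannGMM

theorem mainTheorem12 (d : ℕ) (hd : 0 < d) :
    -- the slicing curves are unit-speed geodesic rays
    (∀ m₁ ∈ Set.Icc (-1 : ℝ) 1,
      BusemannGMM.IsGeodesicRay (BusemannGMM.slicingRay m₁) ∧
      BusemannGMM.W2 (BusemannGMM.slicingRay m₁ 0) (BusemannGMM.slicingRay m₁ 1) = 1) ∧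
    -- the limits that define the Busemann projections exist
    (∀ m₁ ∈ Set.Icc (-1 : ℝ) 1, ∀ (θ : BusemannGMM.UnitSphere d) (μ : BusemannGMM.BW d),
      Tendsto (BusemannGMM.busemannApprox (BusemannGMM.slicingRay m₁) (BusemannGMM.proj θ μ))
        atTop (𝓝 (BusemannGMM.busemann (BusemannGMM.slicingRay m₁) (BusemannGMM.proj θ μ)))) ∧
    -- the integrand in the definition of the discrepancy is measurable
    (∀ P ∈ BusemannGMM.finiteGMM d, ∀ Q ∈ BusemannGMM.finiteGMM d,
      AEMeasurable
        (fun z : BusemannGMM.UnitSphere d × ℝ => BusemannGMM.W2sq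
          (BusemannGMM.projMixture z.1 z.2 P) (BusemannGMM.projMixture z.1 z.2 Q))
        (BusemannGMM.slicingMeasure d)) ∧
    -- the discrepancy is a distance on finite Gaussian mixtures
    BusemannGMM.IsDistanceOn (BusemannGMM.finiteGMM d) BusemannGMM.B1DGMSW := by
  exact ⟨fun m₁ hm => ⟨BusemannGMM.isGeodesicRay_slicingRay hm,
      BusemannGMM.W2_slicingRay_zero_one hm⟩,
    fun m₁ hm θ μ => by
      rw [BusemannGMM.busemann_eq hm]
      exact BusemannGMM.tendsto_busemannApprox hm θ μ,
    fun P hP Q hQ => BusemannGMM.aemeasurable_W2sq_projMixture hd hP hQ,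
    BusemannGMM.isDistanceOn_B1DGMSW hd⟩
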